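/- Let $X$ be a dcpo (every nonempty directed subset has a supremum; no least element is required), equipped with its Scott topology. A set is \emph{saturated} if it is the intersection of its open neighbourhoods, and $X$ is \emph{coherent} if the intersection of any two compact saturated subsets is compact. For $F\subseteq X$ write $F\ll x$ if every directed set whose supremum is above $x$ meets ${\uparrow}F$. The dcpo $X$ is \emph{quasicontinuous} if for every $x$ the family of finite sets $F\ll x$ is nonempty and directed (any two members $F,G$ admit a member $H$ with ${\uparrow}H\subseteq{\uparrow}F\cap{\uparrow}G$) and, whenever $x\not\le y$, there is a finite $F\ll x$ with $y\notin{\uparrow}F$; it is \emph{continuous} if every $x$ is the supremum of the directed set $\{y\mid y\ll x\}$. A \emph{formal lens} is a pair $(C,Q)$ with $C\subseteq X$ closed, $Q\subseteq X$ compact saturated and $C\cap Q\ne\emptyset$; a (real) \emph{lens} is a set of the form $L=C\cap Q$ with $(C,Q)$ a formal lens. Let $\mathbb A=\{\bot<m<\top\}$ with the semilattice operation $a\uplus a=a$ and $a\uplus b=m$ for $a\neq b$, and let $\mathbb A^X$ be the set of Scott-continuous maps $X\to\mathbb A$ with pointwise order and operations $\uplus$, $\vee=\max$, $\wedge=\min$.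 An \emph{$\mathbb A$-valuation} on $X$ is a Scott-continuous map $\phi:\mathbb A^X\to\mathbb A$ which preserves $\uplus$, bottom and top and satisfies, for all $u,v\in\mathbb A^X$: (H1) if $\phi(u)=\bot$ then $\phi(u\vee v)=\phi(v)$; (H2) if $\phi(u)=\top$ then $\phi(u\wedge v)=\phi(v)$. Identify $u\in\mathbb A^X$ with the pair of open sets $U_1=\{u\ne\bot\}\supseteq U_2=\{u=\top\}$. To $\phi:\mathbb A^X\to\mathbb A$ associate, for open $U$, $\phi_1(U)\in\{0,1\}$ with $\phi_1(U)=0$ iff $\phi(U,\emptyset)=\bot$, and $\phi_2(U)\in\{0,1\}$ with $\phi_2(U)=1$ iff $\phi(X,U)=\top$; put $C_\phi=X\setminus\bigcup\{U\mid\phi_1(U)=0\}$ and $Q_\phi=\bigcap\{U\mid \phi_2(U)=1\}$. For a lens $L$ let $\phi_L(U_1,U_2)=\top$ if $L\subseteq U_2$, $\phi_L(U_1,U_2)=\bot$ if $L\cap U_1=\emptyset$, and $\phi_L(U_1,U_2)=m$ otherwise. \textbf{Proposition.} Let $X$ be a coherent quasicontinuous dcpo. Then $L\mapsto\phi_L$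 is a bijection from the set of lenses in $X$ onto the set of $\mathbb A$-valuations on $X$. Moreover, for every lens $L$: for all open $U$, $(\phi_L)_1(U)=0$ iff $L\cap U=\emptyset$, and $(\phi_L)_2(U)=1$ iff $L\subseteq U$; and $\phi_L$ corresponds to the minimal formal lens representing $L$, that is, $C_{\phi_L}=\mathrm{cl}(L)$ and $Q_{\phi_L}={\uparrow}L$, the pair $(\mathrm{cl}(L),{\uparrow}L)$ is a formal lens with $\mathrm{cl}(L)\cap{\uparrow}L=L$, and $\mathrm{cl}(L)\subseteq C$, ${\uparrow}L\subseteq Q$ for every formal lens $(C,Q)$ with $C\cap Q=L$. In particular all this holds for coherent continuous dcpos, since every such dcpo is quasicontinuous. -/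

import Mathlib

noncomputable section

namespace Erratic

/-! ### Directed complete posets, (quasi)continuity, coherence -/

/-- Every (nonempty) directed subset has a supremum. No least element is required. -/
def IsDcpo (X : Type*) [PartialOrder X] : Prop :=
  ∀ d : Set X, d.Nonempty → DirectedOn (· ≤ ·) d → ∃ a, IsLUB d a

/-- The way-below relation between sets and points: `F ≪ x` if every directed set whose
supremum is above `x` meets `↑F`. -/
def SetWayBelow {X : Type*} [PartialOrder X] (F : Set X) (x : X) : Prop :=
  ∀ d : Set X, d.Nonempty → DirectedOn (· ≤ ·) d → ∀ s, IsLUB d s → x ≤ s →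
    (d ∩ (upperClosure F : Set X)).Nonempty

/-- The way-below relation between points. -/
def WayBelow {X : Type*} [PartialOrder X] (y x : X) : Prop :=
  ∀ d : Set X, d.Nonempty → DirectedOn (· ≤ ·) d → ∀ s, IsLUB d s → x ≤ s → ∃ z ∈ d, y ≤ z

/-- Continuity of a dcpo: every `x` is the supremum of the directed set `{y | y ≪ x}`. -/
def IsContinuousDcpo (X : Type*) [PartialOrder X] : Prop :=
  IsDcpo X ∧ ∀ x : X, {y : X | WayBelow y x}.Nonempty ∧
    DirectedOn (· ≤ ·) {y : X | WayBelow y x} ∧ IsLUB {y : X | WayBelow y x} x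

/-- Quasicontinuity of a dcpo: for every `x` the family of finite `F ≪ x` is directed
(for the preorder `F ≤ G ↔ ↑G ⊆ ↑F`), and whenever `x ≰ y` some such `F` has `y ∉ ↑F`. -/
def IsQuasicontinuousDcpo (X : Type*) [PartialOrder X] : Prop :=
  IsDcpo X ∧ ∀ x : X,
    (∃ F : Set X, F.Finite ∧ SetWayBelow F x) ∧
    (∀ F G : Set X, F.Finite → SetWayBelow F x → G.Finite → SetWayBelow G x →
      ∃ H : Set X, H.Finite ∧ SetWayBelow H x ∧
        (upperClosure H : Set X) ⊆ upperClosure F ∧ (upperClosure H : Set X) ⊆ upperClosure G) ∧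
    (∀ y : X, ¬ x ≤ y → ∃ F : Set X, F.Finite ∧ SetWayBelow F x ∧ y ∉ upperClosure F)

/-- A set is saturated if it is the intersection of its (open) neighbourhoods. -/
def IsSaturatedSet {X : Type*} [TopologicalSpace X] (s : Set X) : Prop := nhdsKer s = s

/-- The intersection of any two compact saturated subsets is compact. -/
def IsCoherentSpace (X : Type*) [TopologicalSpace X] : Prop :=
  ∀ Q R : Set X, IsCompact Q → IsSaturatedSet Q → IsCompact R → IsSaturatedSet R →
    IsCompact (Q ∩ R)

/-! ### Lenses -/

/-- Formal lenses `(C, Q)`: `C` closed, `Q` compact saturated, `C ∩ Q` nonempty. -/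
def IsFormalLens {X : Type*} [TopologicalSpace X] (C Q : Set X) : Prop :=
  IsClosed C ∧ IsCompact Q ∧ IsSaturatedSet Q ∧ (C ∩ Q).Nonempty

/-- (Real) lenses: the intersections `C ∩ Q` of formal lenses `(C, Q)`. -/
def IsLens {X : Type*} [TopologicalSpace X] (L : Set X) : Prop :=
  ∃ C Q : Set X, IsFormalLens C Q ∧ C ∩ Q = L

/-! ### The three element chain `𝔸 = {⊥ < m < ⊤}` and the function space `𝔸^X` -/

/-- The chain `⊥ = 0 < m = 1 < ⊤ = 2`. -/
abbrev A : Type := Fin 3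

/-- The middle element `m`. -/
def A.mid : A := 1

/-- The semilattice operation on `𝔸` : `a ⊎ a = a`, and `a ⊎ b = m` for `a ≠ b`. -/
def A.choice (a b : A) : A := if a = b then a else A.mid

/-- The Scott-continuous maps `X → 𝔸`, ordered pointwise. -/
abbrev AMap (X : Type*) [PartialOrder X] : Type _ := {u : X → A // ScottContinuous u}

section

variable {X : Type*} [PartialOrder X]

theorem scottContinuous_of_attained {u : X → A} (hu : Monotone u)
    (h : ∀ d : Set X, d.Nonempty → DirectedOn (· ≤ ·) d → ∀ s, IsLUB d s → ∃ z ∈ d, u z = u s) :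
    ScottContinuous u := by
  intro d hd hdir s hs
  obtain ⟨z, hz, hzs⟩ := h d hd hdir s hs
  refine ⟨?_, fun b hb => hzs ▸ hb ⟨z, hz, rfl⟩⟩
  rintro _ ⟨w, hw, rfl⟩
  exact hu (hs.1 hw)

theorem ScottContinuous.attained {u : X → A} (hu : ScottContinuous u) {d : Set X}
    (hd : d.Nonempty) (hdir : DirectedOn (· ≤ ·) d) {s : X} (hs : IsLUB d s) :
    ∃ z ∈ d, u z = u s := by
  obtain ⟨_, ⟨z, hz, rfl⟩, hmax⟩ :=
    Set.exists_max_image (u '' d) id (Set.toFinite _) (hd.image u)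
  refine ⟨z, hz, le_antisymm ((hu hd hdir hs).1 ⟨z, hz, rfl⟩) ((hu hd hdir hs).2 ?_)⟩
  exact fun b hb => hmax b hb

theorem ScottContinuous.map₂ {u v : X → A} (hu : ScottContinuous u) (hv : ScottContinuous v)
    {g : A → A → A} (hg : ∀ a a' b b', a ≤ a' → b ≤ b' → g a b ≤ g a' b') :
    ScottContinuous fun x => g (u x) (v x) := by
  have mu := hu.monotone
  have mv := hv.monotone
  refine scottContinuous_of_attained (fun x y h => hg _ _ _ _ (mu h) (mv h)) ?_
  intro d hd hdir s hs
  obtain ⟨z, hz, hzs⟩ := ScottContinuous.attained hu hd hdir hs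
  obtain ⟨w, hw, hws⟩ := ScottContinuous.attained hv hd hdir hs
  obtain ⟨t, ht, hzt, hwt⟩ := hdir z hz w hw
  have h1 : u t = u s := le_antisymm (mu (hs.1 ht)) (hzs ▸ mu hzt)
  have h2 : v t = v s := le_antisymm (mv (hs.1 ht)) (hws ▸ mv hwt)
  exact ⟨t, ht, by simp only [h1, h2]⟩

/-- Constant maps. -/
def AMap.const (a : A) : AMap X :=
  ⟨fun _ => a, scottContinuous_of_attained (fun _ _ _ => le_rfl)
    fun _ hd _ _ _ => ⟨hd.choose, hd.choose_spec, rfl⟩⟩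

/-- Pointwise maximum `u ∨ v`. -/
def AMap.max (u v : AMap X) : AMap X :=
  ⟨fun x => u.1 x ⊔ v.1 x, ScottContinuous.map₂ u.2 v.2 (g := fun a b => a ⊔ b) (by decide)⟩

/-- Pointwise minimum `u ∧ v`. -/
def AMap.min (u v : AMap X) : AMap X :=
  ⟨fun x => u.1 x ⊓ v.1 x, ScottContinuous.map₂ u.2 v.2 (g := fun a b => a ⊓ b) (by decide)⟩

/-- The pointwise semilattice operation `u ⊎ v`. -/
def AMap.choice (u v : AMap X) : AMap X :=
  ⟨fun x => A.choice (u.1 x) (v.1 x), ScottContinuous.map₂ u.2 v.2 (by decide)⟩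

/-! ### `𝔸`-valuations -/

/-- `𝔸`-valuations on `X`: the Scott-continuous semilattice homomorphisms `𝔸^X → 𝔸` that
preserve bottom and top and satisfy (H1) and (H2). -/
structure IsAValuation (φ : AMap X → A) : Prop where
  scottContinuous : ScottContinuous φ
  map_choice : ∀ u v, φ (AMap.choice u v) = A.choice (φ u) (φ v)
  map_bot : φ (AMap.const ⊥) = ⊥
  map_top : φ (AMap.const ⊤) = ⊤
  /-- (H1) -/
  map_max : ∀ u v, φ u = ⊥ → φ (AMap.max u v) = φ v
  /-- (H2) -/
  map_min : ∀ u v, φ u = ⊤ → φ (AMap.min u v) = φ v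

open Classical in
/-- The map `φ_L : 𝔸^X → 𝔸`. Writing `u` as the pair `U₁ = {x | u x ≠ ⊥} ⊇ U₂ = {x | u x = ⊤}`
of open sets, `φ_L u` is the element `(φ₁ U₁, φ₂ U₂)` of `𝔸 = {⊥ = (0,0), m = (1,0), ⊤ = (1,1)}`,
where `φ₁ U = 0` iff `L ∩ U = ∅` and `φ₂ U = 1` iff `L ⊆ U`. -/
def lensValuation (L : Set X) (u : AMap X) : A :=
  if L ⊆ {x | u.1 x = ⊤} then ⊤ else if L ∩ {x | u.1 x ≠ ⊥} = ∅ then ⊥ else A.mid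

variable [TopologicalSpace X] [Topology.IsScott X Set.univ]

open Classical in
/-- The element of `𝔸^X` represented by a pair `U₁ ⊇ U₂` of open sets. -/
def AMap.ofOpens (U₁ U₂ : TopologicalSpace.Opens X) (_h : U₂ ≤ U₁) : AMap X :=
  ⟨fun x => if x ∈ U₂ then ⊤ else if x ∈ U₁ then A.mid else ⊥, by
    have h₁ := (Topology.IsScott.isOpen_iff_isUpperSet_and_dirSupInaccOn (D := Set.univ)).1 U₁.2
    have h₂ := (Topology.IsScott.isOpen_iff_isUpperSet_and_dirSupInaccOn (D := Set.univ)).1 U₂.2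
    have up₁ : ∀ {x y : X}, x ≤ y → x ∈ U₁ → y ∈ U₁ := fun hxy hx => h₁.1 hxy hx
    have up₂ : ∀ {x y : X}, x ≤ y → x ∈ U₂ → y ∈ U₂ := fun hxy hx => h₂.1 hxy hx
    refine scottContinuous_of_attained ?_ ?_
    · intro x y hxy
      have a₁ := up₁ hxy
      have a₂ := up₂ hxy
      by_cases y₂ : y ∈ U₂
      · simp only [y₂, if_true]; exact le_top
      · have x₂ : x ∉ U₂ := fun hx => y₂ (a₂ hx)
        by_cases x₁ : x ∈ U₁
        · simp [x₂, y₂, x₁, a₁ x₁]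
        · simp [x₂, x₁]
    · intro d hd hdir s hs
      by_cases s₂ : s ∈ U₂
      · obtain ⟨z, hz, hz₂⟩ := h₂.2 (Set.mem_univ d) hd hdir hs s₂
        have hz₂ : z ∈ U₂ := hz₂
        exact ⟨z, hz, by simp [s₂, hz₂]⟩
      · have n₂ : ∀ z ∈ d, z ∉ U₂ := fun z hz hz₂ => s₂ (up₂ (hs.1 hz) hz₂)
        by_cases s₁ : s ∈ U₁
        · obtain ⟨z, hz, hz₁⟩ := h₁.2 (Set.mem_univ d) hd hdir hs s₁
          have hz₁ : z ∈ U₁ := hz₁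
          exact ⟨z, hz, by simp [s₂, n₂ z hz, s₁, hz₁]⟩
        · obtain ⟨z, hz⟩ := hd
          have n₁ : z ∉ U₁ := fun hz₁ => s₁ (up₁ (hs.1 hz) hz₁)
          exact ⟨z, hz, by simp [s₂, n₂ z hz, s₁, n₁]⟩⟩

/-- The first component `φ₁ : Σ^X → Σ` of `φ : 𝔸^X → 𝔸`, `φ₁(U) = π₁(φ(U, ∅))`, as a predicate
(`π₁ a = 1` iff `a ≠ ⊥`). -/
def fstComponent (φ : AMap X → A) (U : TopologicalSpace.Opens X) : Prop :=
  φ (AMap.ofOpens U ⊥ bot_le) ≠ ⊥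

/-- The second component `φ₂ : Σ^X → Σ` of `φ : 𝔸^X → 𝔸`, `φ₂(U) = π₂(φ(X, U))`, as a predicate
(`π₂ a = 1` iff `a = ⊤`). -/
def sndComponent (φ : AMap X → A) (U : TopologicalSpace.Opens X) : Prop :=
  φ (AMap.ofOpens ⊤ U le_top) = ⊤

/-- The closed set `C = X \ ⋃ {U | φ₁ U = 0}` of the formal lens associated with `φ`. -/
def assocClosed (φ : AMap X → A) : Set X :=
  (⋃ U ∈ {U : TopologicalSpace.Opens X | ¬ fstComponent φ U}, (U : Set X))ᶜ

/-- The saturated set `Q = ⋂ {U | φ₂ U = 1}` of the formal lens associated with `φ`. -/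
def assocSaturated (φ : AMap X → A) : Set X :=
  ⋂ U ∈ {U : TopologicalSpace.Opens X | sndComponent φ U}, (U : Set X)

end

end Erratic

end

namespace Erratic

variable {X : Type*} [PartialOrder X]

/-! ### Rudin's lemma and the way-below relation -/

/-! A lens is recovered from its valuation because `φ_L` records which open sets miss `L` and which
contain `L`. These determine `cl(L)` and `↑L`, and `L = cl(L) ∩ ↑L` whenever `L = C ∩ Q` with `C`
closed and `Q` saturated.

Conversely, preservation of `⊎` makes `φ` equivalent to the two predicates `φ₁`, `φ₂` on open sets.
By (H1) and continuity there is a largest open `O` with `φ₁ O = 0`; put `C = X \ O`. By (H2) and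
continuity the opens with `φ₂ = 1` form a Scott-open filter, with intersection `Q`, compact by
Hofmann–Mislove. It remains to see that `L = C ∩ Q` induces `φ`.

If `L ⊆ U`, then `Q ⊆ O ∪ U`, so `φ₂ (O ∪ U) = 1` by Hofmann–Mislove, and (H1) deletes `O`. If `L`
misses `U` but `φ₁ U = 1`, quasicontinuity gives a finite `F ⊆ U` such that `φ₁` is still `1` on the
points way above `F`. Now `Q ∩ ↑F ⊆ O`, and since coherence makes the sets `↑K ∩ ↑F` compact, a
second use of Hofmann–Mislove gives `↑K ∩ ↑F ⊆ O` for some finite `K` with `φ₂ = 1` on its way-above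
set. By (H2), `φ₁` is `1` on the points way above both `K` and `F`, hence on `O`, a contradiction.

Rudin's lemma underlies both the interpolation property of finite sets and Hofmann–Mislove. -/

/-- A family of sets that is directed in the Smyth preorder. -/
def SmythDirected (𝓕 : Set (Set X)) : Prop :=
  ∀ F ∈ 𝓕, ∀ G ∈ 𝓕, ∃ H ∈ 𝓕, (upperClosure H : Set X) ⊆ upperClosure F ∧
    (upperClosure H : Set X) ⊆ upperClosure G

/-- Rudin's lemma: a Smyth-directed family of finite sets, none of which is contained in the upper
set `U`, has a directed transversal disjoint from `U`. -/
theorem SmythDirected.exists_directedOn {𝓕 : Set (Set X)} (hne : 𝓕.Nonempty)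
    (hfin : ∀ F ∈ 𝓕, F.Finite) (hdir : SmythDirected 𝓕) {U : Set X} (hU : IsUpperSet U)
    (hFU : ∀ F ∈ 𝓕, ¬ F ⊆ U) :
    ∃ D : Set X, D.Nonempty ∧ DirectedOn (· ≤ ·) D ∧ Disjoint D U ∧
      ∀ F ∈ 𝓕, (F ∩ D).Nonempty := by
  -- The transversal is a minimal lower set meeting every member of the family.
  let S : Set (Set X) := {A | IsLowerSet A ∧ ∀ F ∈ 𝓕, (F ∩ A).Nonempty}
  have hS : Uᶜ ∈ S := by
    refine ⟨hU.compl, fun F hF => ?_⟩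
    obtain ⟨x, hx, hxU⟩ := Set.not_subset.1 (hFU F hF)
    exact ⟨x, hx, hxU⟩
  obtain ⟨A, hAU, hA⟩ := zorn_superset_nonempty S (by
    intro c hcS hc hcne
    refine ⟨⋂₀ c, ⟨isLowerSet_sInter fun s hs => (hcS hs).1, fun F hF => ?_⟩,
      fun s hs => Set.sInter_subset_of_mem hs⟩
    -- Finiteness of `F` makes the traces of the chain on `F` attain a minimum; a point of that
    -- trace lies in every member of the chain.
    obtain ⟨s, ⟨hs, hmin⟩⟩ := Set.Finite.exists_minimal
      (s := (fun t => F ∩ t) '' c)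
      ((hfin F hF).finite_subsets.subset (by
        rintro _ ⟨t, -, rfl⟩
        exact Set.inter_subset_left)) (hcne.image _)
    obtain ⟨t, ht, rfl⟩ := hs
    obtain ⟨x, hxF, hxt⟩ := (hcS ht).2 F hF
    refine ⟨x, hxF, fun r hr => ?_⟩
    rcases hc.total ht hr with h | h
    · exact h hxt
    · exact (hmin ⟨r, hr, rfl⟩ (Set.inter_subset_inter_right F h) ⟨hxF, hxt⟩).2) Uᶜ hS
  -- Otherwise the lower set `A \ ↑a` would still meet every member, against minimality. Combined
  -- with a common refinement of two such `F`, `G`, this yields directedness.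
  have key : ∀ a ∈ A, ∃ F ∈ 𝓕, ∀ x ∈ F, x ∈ A → a ≤ x := by
    intro a ha
    by_contra! hcon
    have hmem : A \ Set.Ici a ∈ S := by
      refine ⟨hA.prop.1.inter (isUpperSet_Ici a).compl, fun F hF => ?_⟩
      obtain ⟨x, hx, hxA, hax⟩ := hcon F hF
      exact ⟨x, hx, hxA, hax⟩
    exact (hA.le_of_le hmem Set.sdiff_subset ha).2 (Set.mem_Ici.2 le_rfl)
  refine ⟨A, ?_, ?_, ?_, hA.prop.2⟩
  · obtain ⟨F, hF⟩ := hne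
    obtain ⟨x, -, hx⟩ := hA.prop.2 F hF
    exact ⟨x, hx⟩
  · intro a ha b hb
    obtain ⟨F, hF, hFa⟩ := key a ha
    obtain ⟨G, hG, hGb⟩ := key b hb
    obtain ⟨H, hH, hHF, hHG⟩ := hdir F hF G hG
    obtain ⟨x, hxH, hxA⟩ := hA.prop.2 H hH
    obtain ⟨f, hf, hfx⟩ := hHF (subset_upperClosure hxH)
    obtain ⟨g, hg, hgx⟩ := hHG (subset_upperClosure hxH)
    exact ⟨x, hxA, (hFa f hf (hA.prop.1 hfx hxA)).trans hfx,
      (hGb g hg (hA.prop.1 hgx hxA)).trans hgx⟩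
  · exact Set.disjoint_left.2 fun x hx => hAU hx

/-- Rudin's lemma in a dcpo, with a supremum of the directed transversal. -/
theorem SmythDirected.exists_isLUB (hX : IsDcpo X) {𝓕 : Set (Set X)} (hne : 𝓕.Nonempty)
    (hfin : ∀ F ∈ 𝓕, F.Finite) (hdir : SmythDirected 𝓕) {U : Set X} (hU : IsUpperSet U)
    (hFU : ∀ F ∈ 𝓕, ¬ F ⊆ U) :
    ∃ (D : Set X) (s : X), D.Nonempty ∧ DirectedOn (· ≤ ·) D ∧ Disjoint D U ∧ IsLUB D s ∧
      ∀ F ∈ 𝓕, s ∈ upperClosure F := by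
  obtain ⟨D, hD, hDdir, hDU, hDF⟩ := hdir.exists_directedOn hne hfin hU hFU
  obtain ⟨s, hs⟩ := hX D hD hDdir
  refine ⟨D, s, hD, hDdir, hDU, hs, fun F hF => ?_⟩
  obtain ⟨x, hxF, hxD⟩ := hDF F hF
  exact ⟨x, hxF, hs.1 hxD⟩

/-- The points way above a set. -/
def wayAbove (F : Set X) : Set X := {x | SetWayBelow F x}

theorem SetWayBelow.mem_upperClosure {F : Set X} {x : X} (h : SetWayBelow F x) :
    x ∈ upperClosure F := by
  obtain ⟨y, rfl, hy⟩ := h {x} ⟨x, rfl⟩ (directedOn_singleton _) x isLUB_singleton le_rfl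
  exact hy

theorem wayAbove_subset (F : Set X) : wayAbove F ⊆ upperClosure F :=
  fun _ h => SetWayBelow.mem_upperClosure h

theorem SetWayBelow.mono {F G : Set X} {x : X} (h : SetWayBelow F x)
    (hFG : (upperClosure F : Set X) ⊆ upperClosure G) : SetWayBelow G x :=
  fun d hd hdir s hs hxs => (h d hd hdir s hs hxs).mono (Set.inter_subset_inter_right d hFG)

theorem upperClosure_subset_of_isUpperSet {F U : Set X} (hU : IsUpperSet U) (h : F ⊆ U) :
    (upperClosure F : Set X) ⊆ U := by
  rintro x ⟨y, hy, hyx⟩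
  exact hU hyx (h hy)

/-- Singletons `{y}` with `y ≪ x` are cofinal: the directed set of such `y` has supremum `x`, so it
meets `↑F` for every `F ≪ x`. -/
theorem IsContinuousDcpo.isQuasicontinuousDcpo (h : IsContinuousDcpo X) :
    IsQuasicontinuousDcpo X := by
  have hsingle : ∀ {x y : X}, WayBelow y x → SetWayBelow {y} x := by
    intro x y hy d hd hdir s hs hxs
    obtain ⟨z, hz, hyz⟩ := hy d hd hdir s hs hxs
    exact ⟨z, hz, y, rfl, hyz⟩
  refine ⟨h.1, fun x => ?_⟩
  obtain ⟨hne, hdir, hlub⟩ := h.2 x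
  refine ⟨?_, ?_, ?_⟩
  · obtain ⟨y, hy⟩ := hne
    exact ⟨{y}, Set.finite_singleton y, hsingle hy⟩
  · intro F G _ hFx _ hGx
    obtain ⟨a, ha, f, hf, hfa⟩ := hFx _ hne hdir x hlub le_rfl
    obtain ⟨b, hb, g, hg, hgb⟩ := hGx _ hne hdir x hlub le_rfl
    obtain ⟨c, hc, hac, hbc⟩ := hdir a ha b hb
    refine ⟨{c}, Set.finite_singleton c, hsingle hc, ?_, ?_⟩
    · rintro z ⟨_, rfl, hz⟩
      exact ⟨f, hf, hfa.trans (hac.trans hz)⟩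
    · rintro z ⟨_, rfl, hz⟩
      exact ⟨g, hg, hgb.trans (hbc.trans hz)⟩
  · intro y hxy
    by_contra! hcon
    refine hxy (hlub.2 fun z hz => ?_)
    obtain ⟨_, rfl, hzy⟩ := hcon {z} (Set.finite_singleton z) (hsingle hz)
    exact hzy

/-- In a quasicontinuous dcpo, if every directed set with supremum above `s = sup d` meets the upper
set `U`, then `U` contains a finite set way below some member of `d`. -/
theorem IsQuasicontinuousDcpo.exists_setWayBelow (h : IsQuasicontinuousDcpo X) {d : Set X}
    (hd : d.Nonempty) (hdir : DirectedOn (· ≤ ·) d) {s : X} (hs : IsLUB d s) {U : Set X}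
    (hU : IsUpperSet U)
    (hUs : ∀ e : Set X, e.Nonempty → DirectedOn (· ≤ ·) e → ∀ t, IsLUB e t → s ≤ t →
      (e ∩ U).Nonempty) :
    ∃ y ∈ d, ∃ F : Set X, F.Finite ∧ SetWayBelow F y ∧ F ⊆ U := by
  by_contra! hcon
  -- If no member of this family lies in `U`, Rudin's lemma gives a directed set avoiding `U` with
  -- supremum `t` in every `↑H`. Separation then forces `s ≤ t`, contradicting `hUs`.
  let 𝓗 : Set (Set X) := {H | H.Finite ∧ ∃ y ∈ d, SetWayBelow H y}
  have hup : ∀ {H : Set X} {y z : X}, SetWayBelow H y → y ≤ z → SetWayBelow H z :=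
    fun hH hyz e he hedir t ht hzt => hH e he hedir t ht (hyz.trans hzt)
  have hne : 𝓗.Nonempty := by
    obtain ⟨y, hy⟩ := hd
    obtain ⟨F, hF, hFy⟩ := (h.2 y).1
    exact ⟨F, hF, y, hy, hFy⟩
  have hsm : SmythDirected 𝓗 := by
    rintro F ⟨hF, y, hy, hFy⟩ G ⟨hG, z, hz, hGz⟩
    obtain ⟨w, hw, hyw, hzw⟩ := hdir y hy z hz
    obtain ⟨H, hH, hHw, hHF, hHG⟩ := (h.2 w).2.1 F G hF (hup hFy hyw) hG (hup hGz hzw)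
    exact ⟨H, ⟨hH, w, hw, hHw⟩, hHF, hHG⟩
  obtain ⟨D, t, hD, hDdir, hDU, hDt, htF⟩ := hsm.exists_isLUB h.1 hne (fun F hF => hF.1) hU
    (by rintro F ⟨hF, y, hy, hFy⟩; exact hcon y hy F hF hFy)
  have hst : s ≤ t := hs.2 fun y hy => by
    by_contra hyt
    obtain ⟨F, hF, hFy, htF'⟩ := (h.2 y).2.2 t hyt
    exact htF' (htF F ⟨hF, y, hy, hFy⟩)
  obtain ⟨x, hx, hxU⟩ := hUs D hD hDdir t hDt hst
  exact Set.disjoint_left.1 hDU hx hxU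

/-! ### The Scott topology of a quasicontinuous dcpo -/

section Scott

variable [TopologicalSpace X] [Topology.IsScott X Set.univ]

open TopologicalSpace

theorem isOpen_iff_scott {U : Set X} : IsOpen U ↔ IsUpperSet U ∧
    ∀ d : Set X, d.Nonempty → DirectedOn (· ≤ ·) d → ∀ s, IsLUB d s → s ∈ U →
      (d ∩ U).Nonempty := by
  rw [Topology.IsScott.isOpen_iff_isUpperSet_and_dirSupInaccOn (D := Set.univ)]
  exact and_congr_right fun _ => ⟨fun h d hd hdir s hs hsU => h (Set.mem_univ d) hd hdir hs hsU,
    fun h d _ hd hdir s hs hsU => h d hd hdir s hs hsU⟩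

theorem isUpperSet_of_isOpen_scott {U : Set X} (hU : IsOpen U) : IsUpperSet U :=
  (isOpen_iff_scott.1 hU).1

theorem isOpen_compl_Iic (x : X) : IsOpen (Set.Iic x)ᶜ := by
  refine isOpen_iff_scott.2 ⟨(isLowerSet_Iic x).compl, fun d hd hdir s hs hsx => ?_⟩
  by_contra hcon
  refine hsx (hs.2 fun y hy => ?_)
  by_contra hyx
  exact hcon ⟨y, hy, hyx⟩

/-- The opens `X \ ↓x` already separate a point from any upper set not containing it, so saturated
means upper. -/
theorem nhdsKer_eq_upperClosure (S : Set X) : nhdsKer S = upperClosure S := by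
  refine Set.Subset.antisymm (fun x hx => ?_) ?_
  · by_contra hxS
    refine mem_nhdsKer.1 hx (Set.Iic x)ᶜ (isOpen_compl_Iic x) ?_ (Set.mem_Iic.2 le_rfl)
    exact fun y hy hyx => hxS ⟨y, hy, hyx⟩
  · rintro x ⟨y, hy, hyx⟩
    exact mem_nhdsKer.2 fun U hU hSU => isUpperSet_of_isOpen_scott hU hyx (hSU hy)

theorem isSaturatedSet_iff {S : Set X} : IsSaturatedSet S ↔ IsUpperSet S := by
  rw [IsSaturatedSet, nhdsKer_eq_upperClosure]
  exact ⟨fun h => h ▸ (upperClosure S).upper, fun h => h.upperClosure⟩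

theorem isCompact_upperClosure {S : Set X} (hS : IsCompact S) :
    IsCompact (upperClosure S : Set X) := by
  rw [← nhdsKer_eq_upperClosure]
  exact hS.nhdsKer

/-- This is interpolation: some `H ≪ y` with `y ∈ d` satisfies `H ⊆ ↑F`, hence `F ≪ y`. -/
theorem IsQuasicontinuousDcpo.isOpen_wayAbove (h : IsQuasicontinuousDcpo X) (F : Set X) :
    IsOpen (wayAbove F) := by
  refine isOpen_iff_scott.2 ⟨fun x y hxy hx d hd hdir s hs hys =>
    hx d hd hdir s hs (hxy.trans hys), fun d hd hdir s hs hsF => ?_⟩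
  obtain ⟨y, hy, H, -, hHy, hHF⟩ := h.exists_setWayBelow hd hdir hs (upperClosure F).upper hsF
  exact ⟨y, hy, hHy.mono (upperClosure_subset_of_isUpperSet (upperClosure F).upper hHF)⟩

theorem IsQuasicontinuousDcpo.exists_subset_of_isOpen (h : IsQuasicontinuousDcpo X) {U : Set X}
    (hU : IsOpen U) {x : X} (hx : x ∈ U) : ∃ F : Set X, F.Finite ∧ F ⊆ U ∧ x ∈ wayAbove F := by
  obtain ⟨hup, hacc⟩ := isOpen_iff_scott.1 hU
  obtain ⟨_, rfl, F, hF, hFx, hFU⟩ := h.exists_setWayBelow (Set.singleton_nonempty x)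
    (directedOn_singleton x) isLUB_singleton hup
    (fun e he hedir t ht hxt => hacc e he hedir t ht (hup hxt hx))
  exact ⟨F, hF, hFU, hFx⟩

/-! ### Finite approximation of opens and Hofmann–Mislove -/

/-- The open set of points way above `F`. -/
def wayAboveOpens (h : IsQuasicontinuousDcpo X) (F : Set X) : Opens X :=
  ⟨wayAbove F, h.isOpen_wayAbove F⟩

/-- A predicate on opens that is inaccessible by directed unions and holds for `U` holds for the
points way above some finite subset of `U`. -/
theorem IsQuasicontinuousDcpo.exists_wayAboveOpens (h : IsQuasicontinuousDcpo X)
    {P : Opens X → Prop}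
    (hP : ∀ S : Set (Opens X), S.Nonempty → DirectedOn (· ≤ ·) S → P (sSup S) → ∃ U ∈ S, P U)
    {U : Opens X} (hU : P U) :
    ∃ F : Set X, F.Finite ∧ F ⊆ U ∧ P (wayAboveOpens h F) := by
  let S : Set (Opens X) := wayAboveOpens h '' {F | F.Finite ∧ F ⊆ U}
  have hsup : sSup S = U := by
    refine le_antisymm (sSup_le ?_) fun x hx => ?_
    · rintro _ ⟨F, ⟨-, hFU⟩, rfl⟩
      exact (wayAbove_subset F).trans
        (upperClosure_subset_of_isUpperSet (isUpperSet_of_isOpen_scott U.2) hFU)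
    · obtain ⟨F, hF, hFU, hxF⟩ := h.exists_subset_of_isOpen U.2 hx
      exact Opens.mem_sSup.2 ⟨_, ⟨F, ⟨hF, hFU⟩, rfl⟩, hxF⟩
  have hdir : DirectedOn (· ≤ ·) S := by
    rintro _ ⟨F, ⟨hF, hFU⟩, rfl⟩ _ ⟨G, ⟨hG, hGU⟩, rfl⟩
    refine ⟨_, ⟨F ∪ G, ⟨hF.union hG, Set.union_subset hFU hGU⟩, rfl⟩, ?_, ?_⟩
    · exact fun x hx => SetWayBelow.mono hx (upperClosure_anti Set.subset_union_left)
    · exact fun x hx => SetWayBelow.mono hx (upperClosure_anti Set.subset_union_right)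
  obtain ⟨_, ⟨F, ⟨hF, hFU⟩, rfl⟩, hPF⟩ :=
    hP S ⟨_, ∅, ⟨Set.finite_empty, Set.empty_subset _⟩, rfl⟩ hdir (hsup.symm ▸ hU)
  exact ⟨F, hF, hFU, hPF⟩

/-- Scott-open filters of open sets. -/
structure IsScottOpenFilter (𝓕 : Set (Opens X)) : Prop where
  top_mem : ⊤ ∈ 𝓕
  mem_of_le : ∀ {U V : Opens X}, U ∈ 𝓕 → U ≤ V → V ∈ 𝓕
  inf_mem : ∀ {U V : Opens X}, U ∈ 𝓕 → V ∈ 𝓕 → U ⊓ V ∈ 𝓕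
  exists_mem : ∀ S : Set (Opens X), S.Nonempty → DirectedOn (· ≤ ·) S → sSup S ∈ 𝓕 →
    ∃ U ∈ S, U ∈ 𝓕

/-- The Hofmann–Mislove theorem for quasicontinuous dcpos. -/
theorem IsScottOpenFilter.mem_of_sInter_subset (h : IsQuasicontinuousDcpo X)
    {𝓕 : Set (Opens X)} (h𝓕 : IsScottOpenFilter 𝓕) {U : Opens X}
    (hU : (⋂ V ∈ 𝓕, (V : Set X)) ⊆ U) : U ∈ 𝓕 := by
  -- These finite sets are cofinal in the filter, so a point in all their upper closures lies in
  -- every member of the filter, hence in `U`.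
  let 𝓗 : Set (Set X) := {F | F.Finite ∧ wayAboveOpens h F ∈ 𝓕}
  have hsub : ∀ {V : Opens X}, V ∈ 𝓕 → ∃ F ∈ 𝓗, F ⊆ V := fun hV => by
    obtain ⟨F, hF, hFV, hF𝓕⟩ := h.exists_wayAboveOpens h𝓕.exists_mem hV
    exact ⟨F, ⟨hF, hF𝓕⟩, hFV⟩
  have hsm : SmythDirected 𝓗 := by
    rintro F ⟨-, hF⟩ G ⟨-, hG⟩
    obtain ⟨H, hH, hHFG⟩ := hsub (h𝓕.inf_mem hF hG)
    refine ⟨H, hH, ?_, ?_⟩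
    · exact upperClosure_subset_of_isUpperSet (upperClosure F).upper
        fun x hx => wayAbove_subset F (hHFG hx).1
    · exact upperClosure_subset_of_isUpperSet (upperClosure G).upper
        fun x hx => wayAbove_subset G (hHFG hx).2
  have hex : ∃ F ∈ 𝓗, F ⊆ U := by
    by_contra! hcon
    obtain ⟨F₀, hF₀, -⟩ := hsub h𝓕.top_mem
    obtain ⟨D, s, hD, hDdir, hDU, hs, hsF⟩ := hsm.exists_isLUB h.1 ⟨F₀, hF₀⟩ (fun F hF => hF.1)
      (isUpperSet_of_isOpen_scott U.2) hcon
    have hsU : s ∈ U := hU <| Set.mem_iInter₂.2 fun V hV => by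
      obtain ⟨F, hF, hFV⟩ := hsub hV
      exact upperClosure_subset_of_isUpperSet (isUpperSet_of_isOpen_scott V.2) hFV (hsF F hF)
    obtain ⟨x, hxD, hxU⟩ := (isOpen_iff_scott.1 U.2).2 D hD hDdir s hs hsU
    exact Set.disjoint_left.1 hDU hxD hxU
  obtain ⟨F, ⟨-, hF⟩, hFU⟩ := hex
  exact h𝓕.mem_of_le hF ((wayAbove_subset F).trans
    (upperClosure_subset_of_isUpperSet (isUpperSet_of_isOpen_scott U.2) hFU))

/-- The union of a cover belongs to the filter by Hofmann–Mislove, and Scott-openness passes this on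
to a finite subunion. -/
theorem IsScottOpenFilter.isCompact_sInter (h : IsQuasicontinuousDcpo X)
    {𝓕 : Set (Opens X)} (h𝓕 : IsScottOpenFilter 𝓕) : IsCompact (⋂ V ∈ 𝓕, (V : Set X)) := by
  refine isCompact_of_finite_subcover fun {ι} W hW hcov => ?_
  let S : Set (Opens X) := Set.range fun t : Finset ι => (⟨⋃ i ∈ t, W i,
    isOpen_biUnion fun i _ => hW i⟩ : Opens X)
  have hdir : DirectedOn (· ≤ ·) S := by
    classical
    rintro _ ⟨s, rfl⟩ _ ⟨t, rfl⟩
    refine ⟨_, ⟨s ∪ t, rfl⟩, ?_, ?_⟩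
    · exact Set.biUnion_subset_biUnion_left fun i hi => Finset.mem_union_left t hi
    · exact Set.biUnion_subset_biUnion_left fun i hi => Finset.mem_union_right s hi
  have hmem : sSup S ∈ 𝓕 := h𝓕.mem_of_sInter_subset h fun x hx => by
    obtain ⟨i, hi⟩ := Set.mem_iUnion.1 (hcov hx)
    exact Opens.mem_sSup.2 ⟨_, ⟨{i}, rfl⟩, Set.mem_iUnion₂.2 ⟨i, Finset.mem_singleton_self i, hi⟩⟩
  obtain ⟨_, ⟨t, rfl⟩, ht⟩ := h𝓕.exists_mem S (Set.range_nonempty _) hdir hmem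
  exact ⟨t, Set.biInter_subset_of_mem ht⟩

end Scott

end Erratic

namespace Erratic

/-! ### Arithmetic of the three element chain -/

theorem A.ext_iff_top_bot {a b : A} (h₁ : a = ⊤ ↔ b = ⊤) (h₂ : a = ⊥ ↔ b = ⊥) : a = b := by
  revert a b; decide

theorem A.choice_eq_top {a b : A} : A.choice a b = ⊤ ↔ a = ⊤ ∧ b = ⊤ := by
  revert a b; decide

theorem A.choice_eq_bot {a b : A} : A.choice a b = ⊥ ↔ a = ⊥ ∧ b = ⊥ := by
  revert a b; decide

theorem A.mid_ne_top : A.mid ≠ ⊤ := by decide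

theorem A.mid_ne_bot : A.mid ≠ ⊥ := by decide

/-! ### Basic properties of lenses -/

theorem IsLens.nonempty {X : Type*} [TopologicalSpace X] {L : Set X} (hL : IsLens L) : L.Nonempty := by
  obtain ⟨C, Q, h, rfl⟩ := hL
  exact h.2.2.2

theorem IsLens.isCompact {X : Type*} [TopologicalSpace X] {L : Set X} (hL : IsLens L) : IsCompact L := by
  obtain ⟨C, Q, h, rfl⟩ := hL
  exact h.2.1.inter_left h.1

theorem IsFormalLens.closure_subset {X : Type*} [TopologicalSpace X] {C Q : Set X} (h : IsFormalLens C Q) :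
    closure (C ∩ Q) ⊆ C :=
  closure_minimal Set.inter_subset_left h.1

variable {X : Type*} [PartialOrder X]

theorem AMap.ext_top_bot {u v : AMap X} (h₁ : ∀ x, u.1 x = ⊤ ↔ v.1 x = ⊤)
    (h₂ : ∀ x, u.1 x = ⊥ ↔ v.1 x = ⊥) : u = v :=
  Subtype.ext (funext fun x => A.ext_iff_top_bot (h₁ x) (h₂ x))

/-! ### The valuation of a lens -/

theorem lensValuation_eq_top {L : Set X} {u : AMap X} :
    lensValuation L u = ⊤ ↔ ∀ x ∈ L, u.1 x = ⊤ := by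
  unfold lensValuation
  split_ifs with h₁ h₂
  · exact ⟨fun _ => h₁, fun _ => rfl⟩
  · exact ⟨fun h => absurd h (by decide), fun h => absurd h h₁⟩
  · exact ⟨fun h => absurd h A.mid_ne_top, fun h => absurd h h₁⟩

theorem lensValuation_eq_bot {L : Set X} (hL : L.Nonempty) {u : AMap X} :
    lensValuation L u = ⊥ ↔ ∀ x ∈ L, u.1 x = ⊥ := by
  have hiff : L ∩ {x | u.1 x ≠ ⊥} = ∅ ↔ ∀ x ∈ L, u.1 x = ⊥ := by
    simp [Set.eq_empty_iff_forall_notMem]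
  unfold lensValuation
  split_ifs with h₁ h₂
  · obtain ⟨x, hx⟩ := hL
    refine ⟨fun h => absurd h (by decide), fun h => ?_⟩
    exact absurd ((h x hx).symm.trans (h₁ hx)) (by decide)
  · exact ⟨fun _ => hiff.1 h₂, fun _ => rfl⟩
  · exact ⟨fun h => absurd h A.mid_ne_bot, fun h => absurd (hiff.2 h) h₂⟩

theorem lensValuation_congr {L : Set X} (hL : L.Nonempty) {u v : AMap X}
    (h : ∀ x ∈ L, u.1 x = v.1 x) : lensValuation L u = lensValuation L v := by
  refine A.ext_iff_top_bot ?_ ?_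
  · rw [lensValuation_eq_top, lensValuation_eq_top]
    exact forall₂_congr fun x hx => by rw [h x hx]
  · rw [lensValuation_eq_bot hL, lensValuation_eq_bot hL]
    exact forall₂_congr fun x hx => by rw [h x hx]

theorem lensValuation_monotone (L : Set X) : Monotone (lensValuation L) := by
  intro u v huv
  -- For empty `L` the test for `⊤` comes first, so the value is constantly `⊤`.
  rcases L.eq_empty_or_nonempty with rfl | hL
  · exact le_of_eq ((lensValuation_eq_top.2 (by simp)).trans
      (lensValuation_eq_top.2 (by simp)).symm)
  have h₁ : lensValuation L u = ⊤ → lensValuation L v = ⊤ := fun h =>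
    lensValuation_eq_top.2 fun x hx => top_le_iff.1
      ((lensValuation_eq_top.1 h x hx).symm.le.trans (huv x))
  have h₂ : lensValuation L v = ⊥ → lensValuation L u = ⊥ := fun h =>
    (lensValuation_eq_bot hL).2 fun x hx => le_bot_iff.1
      ((huv x).trans ((lensValuation_eq_bot hL).1 h x hx).le)
  have key : ∀ a b : A, (a = ⊤ → b = ⊤) → (b = ⊥ → a = ⊥) → a ≤ b := by decide
  exact key _ _ h₁ h₂

section Scott

variable [TopologicalSpace X] [Topology.IsScott X Set.univ]

open TopologicalSpace

theorem ofOpens_eq_top {U₁ U₂ : Opens X} {h : U₂ ≤ U₁} {x : X} :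
    (AMap.ofOpens U₁ U₂ h).1 x = ⊤ ↔ x ∈ U₂ := by
  simp only [AMap.ofOpens]
  split_ifs with h₂ h₁
  · simp [h₂]
  · simp [h₂, A.mid_ne_top]
  · simp [h₂]

theorem ofOpens_eq_bot {U₁ U₂ : Opens X} {h : U₂ ≤ U₁} {x : X} :
    (AMap.ofOpens U₁ U₂ h).1 x = ⊥ ↔ x ∉ U₁ := by
  simp only [AMap.ofOpens]
  split_ifs with h₂ h₁
  · simp [h h₂]
  · simp [h₁, A.mid_ne_bot]
  · simp [h₁]

theorem AMap.isOpen_setOf {u : AMap X} {P : A → Prop} (hP : ∀ a b, a ≤ b → P a → P b) :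
    IsOpen {x | P (u.1 x)} := by
  refine isOpen_iff_scott.2 ⟨fun x y hxy hx => hP _ _ (u.2.monotone hxy) hx,
    fun d hd hdir s hs hsP => ?_⟩
  obtain ⟨z, hz, hzs⟩ := ScottContinuous.attained u.2 hd hdir hs
  exact ⟨z, hz, show P (u.1 z) from hzs ▸ hsP⟩

/-- The open set where a map takes the value `⊤`. -/
def AMap.topOpens (u : AMap X) : Opens X :=
  ⟨{x | u.1 x = ⊤}, AMap.isOpen_setOf (P := (· = ⊤)) (by decide)⟩

/-- The open set where a map does not take the value `⊥`. -/
def AMap.supportOpens (u : AMap X) : Opens X :=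
  ⟨{x | u.1 x ≠ ⊥}, AMap.isOpen_setOf (P := (· ≠ ⊥)) (by decide)⟩

theorem AMap.mem_topOpens {u : AMap X} {x : X} : x ∈ u.topOpens ↔ u.1 x = ⊤ := Iff.rfl

theorem AMap.mem_supportOpens {u : AMap X} {x : X} : x ∈ u.supportOpens ↔ u.1 x ≠ ⊥ := Iff.rfl

/-- Suprema in `𝔸^X` are bounded by the unions of the associated open sets. -/
theorem AMap.le_ofOpens_of_isLUB {d : Set (AMap X)} {s : AMap X} (hs : IsLUB d s)
    {U₁ U₂ : Opens X} (h : U₂ ≤ U₁) (h₁ : ∀ u ∈ d, u.supportOpens ≤ U₁)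
    (h₂ : ∀ u ∈ d, u.topOpens ≤ U₂) : s ≤ AMap.ofOpens U₁ U₂ h := by
  refine hs.2 fun u hu x => ?_
  have key : ∀ a b : A, (a = ⊤ → b = ⊤) → (b = ⊥ → a = ⊥) → a ≤ b := by decide
  refine key _ _ (fun hx => ofOpens_eq_top.2 (h₂ u hu hx)) fun hx => ?_
  by_contra hx'
  exact ofOpens_eq_bot.1 hx (h₁ u hu hx')

/-- The explicit bound with first component `X` and second component the union of the `⊤`-sets
dominates the abstract supremum, so the latter is `⊤` only on that union. -/
theorem AMap.exists_eq_top_of_isLUB {d : Set (AMap X)} {s : AMap X} (hs : IsLUB d s) {x : X}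
    (hx : s.1 x = ⊤) : ∃ u ∈ d, u.1 x = ⊤ := by
  have hle := AMap.le_ofOpens_of_isLUB hs (U₁ := ⊤) (U₂ := sSup (AMap.topOpens '' d)) le_top
    (fun _ _ => le_top) (fun u hu => le_sSup ⟨u, hu, rfl⟩) x
  rw [hx, top_le_iff, ofOpens_eq_top, Opens.mem_sSup] at hle
  obtain ⟨_, ⟨u, hu, rfl⟩, hux⟩ := hle
  exact ⟨u, hu, hux⟩

theorem AMap.exists_ne_bot_of_isLUB {d : Set (AMap X)} {s : AMap X} (hs : IsLUB d s) {x : X}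
    (hx : s.1 x ≠ ⊥) : ∃ u ∈ d, u.1 x ≠ ⊥ := by
  have hle := AMap.le_ofOpens_of_isLUB hs (U₁ := sSup (AMap.supportOpens '' d))
    (U₂ := sSup (AMap.supportOpens '' d)) le_rfl (fun u hu => le_sSup ⟨u, hu, rfl⟩)
    (fun u hu => le_trans (fun y hy => ?_) (le_sSup ⟨u, hu, rfl⟩)) x
  · have hne := fun h => hx (le_bot_iff.1 (hle.trans_eq h))
    obtain ⟨_, ⟨u, hu, rfl⟩, hux⟩ := Opens.mem_sSup.1 (not_not.1 (mt ofOpens_eq_bot.2 hne))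
    exact ⟨u, hu, hux⟩
  · have hy' : u.1 y = ⊤ := hy
    exact AMap.mem_supportOpens.2 (by rw [hy']; decide)

theorem lensValuation_attained {L : Set X} (hL : L.Nonempty) (hc : IsCompact L)
    {d : Set (AMap X)} (hd : d.Nonempty) (hdir : DirectedOn (· ≤ ·) d) {s : AMap X}
    (hs : IsLUB d s) : ∃ u ∈ d, lensValuation L u = lensValuation L s := by
  by_cases htop : lensValuation L s = ⊤
  -- Only the value `⊤` needs compactness; a value other than `⊥` is witnessed at a single point of
  -- `L`.
  · have : Nonempty d := hd.to_subtype
    obtain ⟨⟨u, hu⟩, huL⟩ := hc.elim_directed_cover (fun u : d => {x | u.1.1 x = ⊤})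
      (fun u => u.1.topOpens.2)
      (fun x hx => by
        obtain ⟨u, hu, hux⟩ := AMap.exists_eq_top_of_isLUB hs (lensValuation_eq_top.1 htop x hx)
        exact Set.mem_iUnion.2 ⟨⟨u, hu⟩, hux⟩)
      (by
        rintro ⟨u, hu⟩ ⟨v, hv⟩
        obtain ⟨w, hw, huw, hvw⟩ := hdir u hu v hv
        exact ⟨⟨w, hw⟩, fun x (hx : u.1 x = ⊤) => top_le_iff.1 (hx.symm.le.trans (huw x)),
          fun x (hx : v.1 x = ⊤) => top_le_iff.1 (hx.symm.le.trans (hvw x))⟩)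
    exact ⟨u, hu, (lensValuation_eq_top.2 huL).trans htop.symm⟩
  have hmono := lensValuation_monotone L
  by_cases hbot : lensValuation L s = ⊥
  · obtain ⟨u, hu⟩ := hd
    exact ⟨u, hu, le_antisymm (hmono (hs.1 hu)) (hbot ▸ bot_le)⟩
  · rw [lensValuation_eq_bot hL] at hbot
    push Not at hbot
    obtain ⟨x, hx, hxs⟩ := hbot
    obtain ⟨u, hu, hux⟩ := AMap.exists_ne_bot_of_isLUB hs hxs
    have hub : lensValuation L u ≠ ⊥ := fun h => hux ((lensValuation_eq_bot hL).1 h x hx)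
    have key : ∀ a b : A, a ≠ ⊥ → b ≠ ⊤ → a ≤ b → a = b := by decide
    exact ⟨u, hu, key _ _ hub htop (hmono (hs.1 hu))⟩

theorem isAValuation_lensValuation {L : Set X} (hL : L.Nonempty) (hc : IsCompact L) :
    IsAValuation (lensValuation L) where
  scottContinuous := scottContinuous_of_attained (lensValuation_monotone L)
    fun _ hd hdir _ hs => lensValuation_attained hL hc hd hdir hs
  map_choice u v := by
    refine A.ext_iff_top_bot ?_ ?_
    · simp only [A.choice_eq_top, lensValuation_eq_top, AMap.choice]
      exact forall₂_and
    · simp only [A.choice_eq_bot, lensValuation_eq_bot hL, AMap.choice]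
      exact forall₂_and
  map_bot := (lensValuation_eq_bot hL).2 fun _ _ => rfl
  map_top := lensValuation_eq_top.2 fun _ _ => rfl
  map_max u v hu := lensValuation_congr hL fun x hx => by
    simp only [AMap.max, (lensValuation_eq_bot hL).1 hu x hx, bot_sup_eq]
  map_min u v hu := lensValuation_congr hL fun x hx => by
    simp only [AMap.min, lensValuation_eq_top.1 hu x hx, top_inf_eq]

/-! ### The minimal formal lens of a lens -/

theorem IsFormalLens.upperClosure_subset {C Q : Set X} (h : IsFormalLens C Q) :
    (upperClosure (C ∩ Q) : Set X) ⊆ Q :=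
  upperClosure_subset_of_isUpperSet (isSaturatedSet_iff.1 h.2.2.1) Set.inter_subset_right

theorem IsLens.closure_inter_upperClosure {L : Set X} (hL : IsLens L) :
    closure L ∩ (upperClosure L : Set X) = L := by
  refine Set.Subset.antisymm ?_ (Set.subset_inter subset_closure subset_upperClosure)
  obtain ⟨C, Q, h, rfl⟩ := hL
  exact Set.inter_subset_inter h.closure_subset h.upperClosure_subset

theorem IsLens.isFormalLens {L : Set X} (hL : IsLens L) :
    IsFormalLens (closure L) (upperClosure L : Set X) :=
  ⟨isClosed_closure, isCompact_upperClosure hL.isCompact,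
    isSaturatedSet_iff.2 (upperClosure L).upper, by
      rw [hL.closure_inter_upperClosure]
      exact hL.nonempty⟩

theorem fstComponent_lensValuation {L : Set X} (hL : L.Nonempty) (U : Opens X) :
    ¬ fstComponent (lensValuation L) U ↔ L ∩ (U : Set X) = ∅ := by
  rw [fstComponent, not_not, lensValuation_eq_bot hL, Set.eq_empty_iff_forall_notMem]
  simp only [ofOpens_eq_bot, Set.mem_inter_iff, not_and, SetLike.mem_coe]

theorem sndComponent_lensValuation (L : Set X) (U : Opens X) :
    sndComponent (lensValuation L) U ↔ L ⊆ (U : Set X) := by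
  rw [sndComponent, lensValuation_eq_top]
  simp only [ofOpens_eq_top]
  rfl

theorem assocClosed_lensValuation {L : Set X} (hL : L.Nonempty) :
    assocClosed (lensValuation L) = closure L := by
  ext x
  simp only [assocClosed, Set.mem_compl_iff, Set.mem_iUnion, Set.mem_ofPred_eq,
    fstComponent_lensValuation hL, mem_closure_iff, SetLike.mem_coe, exists_prop, not_exists,
    not_and]
  constructor
  · intro h U hU hxU
    by_contra hcon
    refine h ⟨U, hU⟩ ?_ hxU
    rw [Set.inter_comm]
    exact Set.not_nonempty_iff_eq_empty.1 hcon
  · intro h U hU hxU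
    obtain ⟨y, hyU, hyL⟩ := h U U.2 hxU
    exact (Set.eq_empty_iff_forall_notMem.1 hU) y ⟨hyL, hyU⟩

theorem assocSaturated_lensValuation (L : Set X) :
    assocSaturated (lensValuation L) = (upperClosure L : Set X) := by
  rw [← nhdsKer_eq_upperClosure]
  ext x
  simp only [assocSaturated, Set.mem_iInter, Set.mem_ofPred_eq, sndComponent_lensValuation,
    mem_nhdsKer, SetLike.mem_coe]
  exact ⟨fun h U hU hLU => h ⟨U, hU⟩ hLU, fun h U hLU => h U U.2 hLU⟩

theorem injOn_lensValuation : Set.InjOn (lensValuation (X := X)) {L | IsLens L} := by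
  intro L hL M hM h
  rw [← IsLens.closure_inter_upperClosure hL, ← IsLens.closure_inter_upperClosure hM,
    ← assocClosed_lensValuation (IsLens.nonempty hL),
    ← assocClosed_lensValuation (IsLens.nonempty hM), ← assocSaturated_lensValuation,
    ← assocSaturated_lensValuation, h]

/-! ### The lens of a valuation -/

theorem AMap.ofOpens_mono {U₁ U₂ V₁ V₂ : Opens X} {h : U₂ ≤ U₁} {h' : V₂ ≤ V₁} (h₁ : U₁ ≤ V₁)
    (h₂ : U₂ ≤ V₂) : AMap.ofOpens U₁ U₂ h ≤ AMap.ofOpens V₁ V₂ h' := by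
  intro x
  have key : ∀ a b : A, (a = ⊤ → b = ⊤) → (b = ⊥ → a = ⊥) → a ≤ b := by decide
  exact key _ _ (fun hx => ofOpens_eq_top.2 (h₂ (ofOpens_eq_top.1 hx)))
    fun hx => ofOpens_eq_bot.2 fun hxU => ofOpens_eq_bot.1 hx (h₁ hxU)

theorem isLUB_ofOpens_bot {S : Set (Opens X)} :
    IsLUB ((fun U => AMap.ofOpens U ⊥ bot_le) '' S) (AMap.ofOpens (sSup S) ⊥ bot_le) := by
  refine ⟨?_, fun v hv x => ?_⟩
  · rintro _ ⟨U, hU, rfl⟩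
    exact AMap.ofOpens_mono (le_sSup hU) le_rfl
  · have key : ∀ a b : A, a ≠ ⊤ → (b = ⊥ → a = ⊥) → a ≤ b := by decide
    refine key _ _ (fun hx => (ofOpens_eq_top.1 hx : x ∈ (⊥ : Opens X)).elim) fun hx => ?_
    refine ofOpens_eq_bot.2 fun hxS => ?_
    obtain ⟨U, hU, hxU⟩ := Opens.mem_sSup.1 hxS
    exact ofOpens_eq_bot.1 (le_bot_iff.1 ((hv ⟨U, hU, rfl⟩ x).trans_eq hx)) hxU

/-- Nonemptiness matters: the supremum of the empty family is `(∅, ∅)`, not `(X, ∅)`. -/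
theorem isLUB_ofOpens_top {S : Set (Opens X)} (hS : S.Nonempty) :
    IsLUB ((fun U => AMap.ofOpens ⊤ U le_top) '' S) (AMap.ofOpens ⊤ (sSup S) le_top) := by
  refine ⟨?_, fun v hv x => ?_⟩
  · rintro _ ⟨U, hU, rfl⟩
    exact AMap.ofOpens_mono le_rfl (le_sSup hU)
  · have key : ∀ a b : A, (a = ⊤ → b = ⊤) → b ≠ ⊥ → a ≤ b := by decide
    refine key _ _ (fun hx => ?_) fun hx => ?_
    · obtain ⟨U, hU, hxU⟩ := Opens.mem_sSup.1 (ofOpens_eq_top.1 hx)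
      exact top_le_iff.1 ((ofOpens_eq_top.2 hxU).symm.le.trans (hv ⟨U, hU, rfl⟩ x))
    · obtain ⟨U, hU⟩ := hS
      exact ofOpens_eq_bot.1 (le_bot_iff.1 ((hv ⟨U, hU, rfl⟩ x).trans_eq hx)) trivial

/-! ### Valuations through their two components -/

namespace IsAValuation

variable {φ : AMap X → A}

/-- The map `u ⊎ ⊥` is the pair `(U₁, ∅)`, and `φ u ⊎ ⊥ = ⊥` exactly when `φ u = ⊥`. Thus `U₂` plays
no role here. -/
theorem eq_bot_iff (hφ : IsAValuation φ) (u : AMap X) :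
    φ u = ⊥ ↔ ¬ fstComponent φ u.supportOpens := by
  have h : AMap.ofOpens u.supportOpens ⊥ bot_le = AMap.choice u (AMap.const ⊥) := by
    refine AMap.ext_top_bot (fun x => ?_) fun x => ?_
    · rw [ofOpens_eq_top]
      simp [AMap.choice, A.choice_eq_top, AMap.const]
    · rw [ofOpens_eq_bot, AMap.mem_supportOpens, not_not]
      simp [AMap.choice, A.choice_eq_bot, AMap.const]
  rw [fstComponent, not_not, h, hφ.map_choice, A.choice_eq_bot, hφ.map_bot]
  simp

theorem eq_top_iff (hφ : IsAValuation φ) (u : AMap X) :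
    φ u = ⊤ ↔ sndComponent φ u.topOpens := by
  have h : AMap.ofOpens ⊤ u.topOpens le_top = AMap.choice u (AMap.const ⊤) := by
    refine AMap.ext_top_bot (fun x => ?_) fun x => ?_
    · rw [ofOpens_eq_top, AMap.mem_topOpens]
      simp [AMap.choice, A.choice_eq_top, AMap.const]
    · rw [ofOpens_eq_bot]
      simp [AMap.choice, A.choice_eq_bot, AMap.const]
  rw [sndComponent, h, hφ.map_choice, A.choice_eq_top, hφ.map_top]
  simp

theorem not_fstComponent_iff (hφ : IsAValuation φ) {U₁ U₂ : Opens X} (h : U₂ ≤ U₁) :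
    ¬ fstComponent φ U₁ ↔ φ (AMap.ofOpens U₁ U₂ h) = ⊥ := by
  rw [hφ.eq_bot_iff]
  have : (AMap.ofOpens U₁ U₂ h).supportOpens = U₁ :=
    Opens.ext (Set.ext fun x => by simp [AMap.mem_supportOpens, ofOpens_eq_bot])
  rw [this]

theorem sndComponent_iff (hφ : IsAValuation φ) {U₁ U₂ : Opens X} (h : U₂ ≤ U₁) :
    sndComponent φ U₂ ↔ φ (AMap.ofOpens U₁ U₂ h) = ⊤ := by
  rw [hφ.eq_top_iff]
  have : (AMap.ofOpens U₁ U₂ h).topOpens = U₂ :=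
    Opens.ext (Set.ext fun x => by simp [AMap.mem_topOpens, ofOpens_eq_top])
  rw [this]

theorem fstComponent_mono (hφ : IsAValuation φ) {U V : Opens X} (hUV : U ≤ V)
    (hU : fstComponent φ U) : fstComponent φ V := fun h =>
  hU (le_bot_iff.1 ((hφ.scottContinuous.monotone (AMap.ofOpens_mono hUV le_rfl)).trans_eq h))

theorem sndComponent_mono (hφ : IsAValuation φ) {U V : Opens X} (hUV : U ≤ V)
    (hU : sndComponent φ U) : sndComponent φ V :=
  top_le_iff.1 (hU.symm.le.trans (hφ.scottContinuous.monotone (AMap.ofOpens_mono le_rfl hUV)))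

theorem exists_fstComponent (hφ : IsAValuation φ) (S : Set (Opens X)) (hS : S.Nonempty)
    (hdir : DirectedOn (· ≤ ·) S) (h : fstComponent φ (sSup S)) : ∃ U ∈ S, fstComponent φ U := by
  obtain ⟨_, ⟨U, hU, rfl⟩, hφU⟩ := ScottContinuous.attained hφ.scottContinuous (hS.image _)
    (by
      rintro _ ⟨U, hU, rfl⟩ _ ⟨V, hV, rfl⟩
      obtain ⟨W, hW, hUW, hVW⟩ := hdir U hU V hV
      exact ⟨_, ⟨W, hW, rfl⟩, AMap.ofOpens_mono hUW le_rfl, AMap.ofOpens_mono hVW le_rfl⟩)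
    (isLUB_ofOpens_bot (S := S))
  exact ⟨U, hU, fun hbot => h (hφU.symm.trans hbot)⟩

theorem exists_sndComponent (hφ : IsAValuation φ) (S : Set (Opens X)) (hS : S.Nonempty)
    (hdir : DirectedOn (· ≤ ·) S) (h : sndComponent φ (sSup S)) : ∃ U ∈ S, sndComponent φ U := by
  obtain ⟨_, ⟨U, hU, rfl⟩, hφU⟩ := ScottContinuous.attained hφ.scottContinuous (hS.image _)
    (by
      rintro _ ⟨U, hU, rfl⟩ _ ⟨V, hV, rfl⟩
      obtain ⟨W, hW, hUW, hVW⟩ := hdir U hU V hV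
      exact ⟨_, ⟨W, hW, rfl⟩, AMap.ofOpens_mono le_rfl hUW, AMap.ofOpens_mono le_rfl hVW⟩)
    (isLUB_ofOpens_top hS)
  exact ⟨U, hU, hφU.trans h⟩

/-- This is (H1) for the pairs `(U, U)` and `(X, V)`. The second component of the first pair must be
`U`, so that the maximum is `(X, U ∪ V)`. -/
theorem sndComponent_sup_iff (hφ : IsAValuation φ) {U V : Opens X} (hU : ¬ fstComponent φ U) :
    sndComponent φ (U ⊔ V) ↔ sndComponent φ V := by
  have h := hφ.map_max _ (AMap.ofOpens ⊤ V le_top) ((hφ.not_fstComponent_iff (le_refl U)).1 hU)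
  have heq : AMap.max (AMap.ofOpens U U le_rfl) (AMap.ofOpens ⊤ V le_top) =
      AMap.ofOpens ⊤ (U ⊔ V) le_top := by
    have key₁ : ∀ a b : A, a ⊔ b = ⊤ ↔ a = ⊤ ∨ b = ⊤ := by decide
    have key₂ : ∀ a b : A, a ⊔ b = ⊥ ↔ a = ⊥ ∧ b = ⊥ := by decide
    refine AMap.ext_top_bot (fun x => ?_) fun x => ?_
    · simp only [AMap.max, key₁, ofOpens_eq_top]
      rfl
    · simp only [AMap.max, key₂, ofOpens_eq_bot]
      simp
  rw [heq] at h
  rw [sndComponent, sndComponent, h]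

theorem not_fstComponent_sup (hφ : IsAValuation φ) {U V : Opens X} (hU : ¬ fstComponent φ U)
    (hV : ¬ fstComponent φ V) : ¬ fstComponent φ (U ⊔ V) := by
  have h := hφ.map_max _ _ (not_not.1 hU) |>.trans (not_not.1 hV)
  have heq : AMap.max (AMap.ofOpens U ⊥ bot_le) (AMap.ofOpens V ⊥ bot_le) =
      AMap.ofOpens (U ⊔ V) ⊥ bot_le := by
    have key₁ : ∀ a b : A, a ⊔ b = ⊤ ↔ a = ⊤ ∨ b = ⊤ := by decide
    have key₂ : ∀ a b : A, a ⊔ b = ⊥ ↔ a = ⊥ ∧ b = ⊥ := by decide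
    refine AMap.ext_top_bot (fun x => ?_) fun x => ?_
    · simp only [AMap.max, key₁, ofOpens_eq_top, or_self]
    · simp only [AMap.max, key₂, ofOpens_eq_bot]
      exact not_or.symm
  rw [heq] at h
  exact not_not.2 h

/-- This is (H2) for `(U, U)` and `(V, ∅)`; using `(X, U)` instead would lose `U` in the minimum. -/
theorem fstComponent_inf_iff (hφ : IsAValuation φ) {U V : Opens X} (hU : sndComponent φ U) :
    fstComponent φ (U ⊓ V) ↔ fstComponent φ V := by
  have h := hφ.map_min _ (AMap.ofOpens V ⊥ bot_le) ((hφ.sndComponent_iff (le_refl U)).1 hU)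
  have heq : AMap.min (AMap.ofOpens U U le_rfl) (AMap.ofOpens V ⊥ bot_le) =
      AMap.ofOpens (U ⊓ V) ⊥ bot_le := by
    have key₁ : ∀ a b : A, a ⊓ b = ⊤ ↔ a = ⊤ ∧ b = ⊤ := by decide
    have key₂ : ∀ a b : A, a ⊓ b = ⊥ ↔ a = ⊥ ∨ b = ⊥ := by decide
    refine AMap.ext_top_bot (fun x => ?_) fun x => ?_
    · simp only [AMap.min, key₁, ofOpens_eq_top]
      exact ⟨fun h => h.2, fun h => h.elim⟩
    · simp only [AMap.min, key₂, ofOpens_eq_bot]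
      exact not_and_or.symm
  rw [heq] at h
  rw [fstComponent, fstComponent, h]

theorem sndComponent_inf (hφ : IsAValuation φ) {U V : Opens X} (hU : sndComponent φ U)
    (hV : sndComponent φ V) : sndComponent φ (U ⊓ V) := by
  have h := hφ.map_min _ _ hU |>.trans hV
  have heq : AMap.min (AMap.ofOpens ⊤ U le_top) (AMap.ofOpens ⊤ V le_top) =
      AMap.ofOpens ⊤ (U ⊓ V) le_top := by
    have key₁ : ∀ a b : A, a ⊓ b = ⊤ ↔ a = ⊤ ∧ b = ⊤ := by decide
    have key₂ : ∀ a b : A, a ⊓ b = ⊥ ↔ a = ⊥ ∨ b = ⊥ := by decide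
    refine AMap.ext_top_bot (fun x => ?_) fun x => ?_
    · simp only [AMap.min, key₁, ofOpens_eq_top]
      rfl
    · simp only [AMap.min, key₂, ofOpens_eq_bot, or_self]
  rwa [heq] at h

theorem fstComponent_top (hφ : IsAValuation φ) : fstComponent φ ⊤ := by
  have h := (hφ.eq_bot_iff (AMap.const ⊤)).not.1 (by rw [hφ.map_top]; decide)
  exact hφ.fstComponent_mono le_top (not_not.1 h)

theorem sndComponent_top (hφ : IsAValuation φ) : sndComponent φ ⊤ :=
  hφ.sndComponent_mono le_top ((hφ.eq_top_iff (AMap.const ⊤)).1 hφ.map_top)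

theorem isScottOpenFilter (hφ : IsAValuation φ) :
    IsScottOpenFilter {U : Opens X | sndComponent φ U} where
  top_mem := hφ.sndComponent_top
  mem_of_le hU hUV := hφ.sndComponent_mono hUV hU
  inf_mem hU hV := hφ.sndComponent_inf hU hV
  exists_mem := hφ.exists_sndComponent

/-- The largest open set on which `φ₁` vanishes. -/
theorem not_fstComponent_sSup (hφ : IsAValuation φ) :
    ¬ fstComponent φ (sSup {U : Opens X | ¬ fstComponent φ U}) := by
  intro h
  have hbot : ¬ fstComponent φ ⊥ := by
    have h := (hφ.eq_bot_iff (AMap.const ⊥)).1 hφ.map_bot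
    exact fun h' => h (hφ.fstComponent_mono bot_le h')
  -- (H1) closes the opens with `φ₁ = 0` under binary unions, so continuity applies to their
  -- supremum.
  have hdir : DirectedOn (· ≤ ·) {U : Opens X | ¬ fstComponent φ U} := fun U hU V hV =>
    ⟨U ⊔ V, hφ.not_fstComponent_sup hU hV, le_sup_left, le_sup_right⟩
  obtain ⟨U, hU, hU'⟩ := hφ.exists_fstComponent _ ⟨⊥, hbot⟩ hdir h
  exact hU hU'

theorem assocClosed_eq (φ : AMap X → A) :
    assocClosed φ = ((sSup {U : Opens X | ¬ fstComponent φ U} : Opens X) : Set X)ᶜ := by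
  rw [assocClosed, Opens.coe_sSup]

/-! ### Recovering the valuation from its lens -/

/-- `φ₂ U = 1` iff `U` contains the lens associated with `φ`. -/
theorem sndComponent_iff_subset (hX : IsQuasicontinuousDcpo X) (hφ : IsAValuation φ)
    (U : Opens X) :
    sndComponent φ U ↔ assocClosed φ ∩ assocSaturated φ ⊆ U := by
  refine ⟨fun h x hx => Set.mem_iInter₂.1 hx.2 U h, fun h => ?_⟩
  -- Enlarging `U` by the complement of `C` is free by (H1) and leaves only `Q ⊆ O ∪ U` to check.
  rw [← hφ.sndComponent_sup_iff hφ.not_fstComponent_sSup]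
  refine hφ.isScottOpenFilter.mem_of_sInter_subset hX fun x hx => ?_
  by_cases hxC : x ∈ assocClosed φ
  · exact Or.inr (h ⟨hxC, hx⟩)
  · rw [assocClosed_eq, Set.mem_compl_iff, not_not] at hxC
    exact Or.inl hxC

/-- The opens containing `↑K ∩ ↑F` for some finite `K` whose way-above set belongs to the filter of
`φ₂` form a Scott-open filter. -/
theorem isScottOpenFilter_inter (hX : IsQuasicontinuousDcpo X) (hcoh : IsCoherentSpace X)
    (hφ : IsAValuation φ) {F : Set X} (hF : F.Finite) :
    IsScottOpenFilter {W : Opens X | ∃ K : Set X, K.Finite ∧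
      sndComponent φ (wayAboveOpens hX K) ∧ (upperClosure K ∩ upperClosure F : Set X) ⊆ W} where
  top_mem := by
    obtain ⟨K, hK, -, hφK⟩ := hX.exists_wayAboveOpens hφ.exists_sndComponent hφ.sndComponent_top
    exact ⟨K, hK, hφK, fun _ _ => trivial⟩
  mem_of_le := by
    rintro U V ⟨K, hK, hφK, hKU⟩ hUV
    exact ⟨K, hK, hφK, hKU.trans hUV⟩
  inf_mem := by
    rintro U V ⟨K, hK, hφK, hKU⟩ ⟨M, hM, hφM, hMV⟩
    obtain ⟨N, hN, hNs, hφN⟩ :=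
      hX.exists_wayAboveOpens hφ.exists_sndComponent (hφ.sndComponent_inf hφK hφM)
    refine ⟨N, hN, hφN, Set.subset_inter (fun x hx => hKU ⟨?_, hx.2⟩) fun x hx => hMV ⟨?_, hx.2⟩⟩
    · exact upperClosure_subset_of_isUpperSet (upperClosure K).upper
        (fun y hy => wayAbove_subset K (hNs hy).1) hx.1
    · exact upperClosure_subset_of_isUpperSet (upperClosure M).upper
        (fun y hy => wayAbove_subset M (hNs hy).2) hx.1
  exists_mem := by
    rintro S hS hdir ⟨K, hK, hφK, hKS⟩
    have : Nonempty S := hS.to_subtype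
    -- Coherence enters here, for two finitely generated upper sets.
    have hc : IsCompact (upperClosure K ∩ upperClosure F : Set X) :=
      hcoh _ _ (isCompact_upperClosure hK.isCompact)
        (isSaturatedSet_iff.2 (upperClosure K).upper) (isCompact_upperClosure hF.isCompact)
        (isSaturatedSet_iff.2 (upperClosure F).upper)
    obtain ⟨⟨U, hU⟩, hKU⟩ := hc.elim_directed_cover (fun U : S => ((U : Opens X) : Set X))
      (fun U => U.1.2)
      (fun x hx => by
        obtain ⟨U, hU, hxU⟩ := Opens.mem_sSup.1 (hKS hx)
        exact Set.mem_iUnion.2 ⟨⟨U, hU⟩, hxU⟩)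
      (by
        rintro ⟨U, hU⟩ ⟨V, hV⟩
        obtain ⟨W, hW, hUW, hVW⟩ := hdir U hU V hV
        exact ⟨⟨W, hW⟩, hUW, hVW⟩)
    exact ⟨U, hU, K, hK, hφK, hKU⟩

/-- `φ₁ U = 0` iff `U` is disjoint from the lens associated with `φ`. -/
theorem not_fstComponent_iff_disjoint (hX : IsQuasicontinuousDcpo X) (hcoh : IsCoherentSpace X)
    (hφ : IsAValuation φ) (U : Opens X) :
    ¬ fstComponent φ U ↔ (assocClosed φ ∩ assocSaturated φ) ∩ (U : Set X) = ∅ := by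
  constructor
  · intro h
    refine Set.eq_empty_iff_forall_notMem.2 fun x hx => ?_
    exact hx.1.1 (Set.mem_iUnion₂.2 ⟨U, h, hx.2⟩)
  · intro hdisj hU
    obtain ⟨F, hF, hFU, hφF⟩ := hX.exists_wayAboveOpens hφ.exists_fstComponent hU
    -- The intersection of this filter lies in `Q ∩ ↑F`, hence in `Q ∩ U`, which is inside `O`
    -- because the lens misses `U`.
    obtain ⟨K, -, hφK, hKF⟩ := (hφ.isScottOpenFilter_inter hX hcoh hF).mem_of_sInter_subset hX
      (U := sSup {U : Opens X | ¬ fstComponent φ U}) (by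
        intro x hx
        have hx' := Set.mem_iInter₂.1 hx
        have hxQ : x ∈ assocSaturated φ := by
          refine Set.mem_iInter₂.2 fun V hV => ?_
          obtain ⟨K, hK, hKV, hφK⟩ := hX.exists_wayAboveOpens hφ.exists_sndComponent hV
          exact hx' V ⟨K, hK, hφK, fun y hy =>
            upperClosure_subset_of_isUpperSet (isUpperSet_of_isOpen_scott V.2) hKV hy.1⟩
        have hxF : x ∈ upperClosure F := by
          by_contra hxF
          obtain ⟨K, hK, -, hφK⟩ :=
            hX.exists_wayAboveOpens hφ.exists_sndComponent hφ.sndComponent_top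
          -- The open set `X \ ↓x` contains `↑F`, so it is in the filter, yet it omits `x`.
          exact hx' ⟨(Set.Iic x)ᶜ, isOpen_compl_Iic x⟩ ⟨K, hK, hφK, fun y hy hyx =>
            hxF ((upperClosure F).upper hyx hy.2)⟩ (Set.mem_Iic.2 le_rfl)
        have hxU : x ∈ (U : Set X) :=
          upperClosure_subset_of_isUpperSet (isUpperSet_of_isOpen_scott U.2) hFU hxF
        have hxC : x ∉ assocClosed φ := fun hxC =>
          Set.eq_empty_iff_forall_notMem.1 hdisj x ⟨⟨hxC, hxQ⟩, hxU⟩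
        rwa [assocClosed_eq, Set.mem_compl_iff, not_not] at hxC)
    -- By (H2), intersecting with the points way above `K` keeps `φ₁ = 1`; monotonicity carries this
    -- to `O`.
    refine hφ.not_fstComponent_sSup (hφ.fstComponent_mono ?_ ((hφ.fstComponent_inf_iff hφK).2 hφF))
    exact fun x hx => hKF ⟨wayAbove_subset K hx.1, wayAbove_subset F hx.2⟩

theorem isFormalLens (hX : IsQuasicontinuousDcpo X) (hcoh : IsCoherentSpace X)
    (hφ : IsAValuation φ) : IsFormalLens (assocClosed φ) (assocSaturated φ) := by
  refine ⟨?_, hφ.isScottOpenFilter.isCompact_sInter hX, isSaturatedSet_iff.2 ?_, ?_⟩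
  · rw [assocClosed_eq]
    exact (Opens.isOpen _).isClosed_compl
  · exact isUpperSet_iInter₂ fun U _ => isUpperSet_of_isOpen_scott U.2
  · by_contra hcon
    refine (hφ.not_fstComponent_iff_disjoint hX hcoh ⊤).2 ?_ hφ.fstComponent_top
    rw [Set.not_nonempty_iff_eq_empty.1 hcon, Set.empty_inter]

/-- Both sides are valuations, so each is determined by its two components, and these agree. -/
theorem lensValuation_eq (hX : IsQuasicontinuousDcpo X) (hcoh : IsCoherentSpace X)
    (hφ : IsAValuation φ) : lensValuation (assocClosed φ ∩ assocSaturated φ) = φ := by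
  have hne := (hφ.isFormalLens hX hcoh).2.2.2
  have hL := isAValuation_lensValuation hne
    ((hφ.isFormalLens hX hcoh).2.1.inter_left (hφ.isFormalLens hX hcoh).1)
  funext u
  refine A.ext_iff_top_bot ?_ ?_
  · rw [hL.eq_top_iff, hφ.eq_top_iff, sndComponent_lensValuation, hφ.sndComponent_iff_subset hX]
  · rw [hL.eq_bot_iff, hφ.eq_bot_iff, fstComponent_lensValuation hne,
      hφ.not_fstComponent_iff_disjoint hX hcoh]

end IsAValuation

/-- For a coherent quasicontinuous dcpo, `L ↦ φ_L` is a bijection from lenses to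
`𝔸`-valuations. -/
theorem bijOn_lensValuation (hX : IsQuasicontinuousDcpo X) (hcoh : IsCoherentSpace X) :
    Set.BijOn (lensValuation (X := X)) {L | IsLens L} {φ | IsAValuation φ} := by
  refine ⟨fun L hL => isAValuation_lensValuation (IsLens.nonempty hL) (IsLens.isCompact hL),
    injOn_lensValuation, fun φ (hφ : IsAValuation φ) => ?_⟩
  exact ⟨_, ⟨_, _, hφ.isFormalLens hX hcoh, rfl⟩, hφ.lensValuation_eq hX hcoh⟩

end Scott

end Erratic

theorem mainTheorem6 {X : Type*} [PartialOrder X] [TopologicalSpace X]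
    [Topology.IsScott X Set.univ] (hcoh : Erratic.IsCoherentSpace X) :
    (Erratic.IsContinuousDcpo X → Erratic.IsQuasicontinuousDcpo X) ∧
    (Erratic.IsQuasicontinuousDcpo X →
      Set.BijOn (Erratic.lensValuation (X := X)) {L | Erratic.IsLens L}
        {φ | Erratic.IsAValuation φ} ∧
      ∀ L : Set X, Erratic.IsLens L →
        (∀ U : TopologicalSpace.Opens X,
          (¬ Erratic.fstComponent (Erratic.lensValuation L) U ↔ L ∩ (U : Set X) = ∅) ∧
          (Erratic.sndComponent (Erratic.lensValuation L) U ↔ L ⊆ (U : Set X))) ∧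
        Erratic.assocClosed (Erratic.lensValuation L) = closure L ∧
        Erratic.assocSaturated (Erratic.lensValuation L) = (upperClosure L : Set X) ∧
        Erratic.IsFormalLens (closure L) (upperClosure L : Set X) ∧
        closure L ∩ (upperClosure L : Set X) = L ∧
        ∀ C Q : Set X, Erratic.IsFormalLens C Q → C ∩ Q = L →
          closure L ⊆ C ∧ (upperClosure L : Set X) ⊆ Q) := by
  refine ⟨fun h => h.isQuasicontinuousDcpo, fun hX =>
    ⟨Erratic.bijOn_lensValuation hX hcoh, fun L hL => ⟨fun U =>
      ⟨Erratic.fstComponent_lensValuation hL.nonempty U, Erratic.sndComponent_lensValuation L U⟩,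
      Erratic.assocClosed_lensValuation hL.nonempty, Erratic.assocSaturated_lensValuation L,
      hL.isFormalLens, hL.closure_inter_upperClosure, ?_⟩⟩⟩
  rintro C Q hCQ rfl
  exact ⟨hCQ.closure_subset, hCQ.upperClosure_subset⟩
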